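/- Let $K$ be an infinite field and let $\Lambda$ be a finite dimensional hereditary $K$-algebra. Let $S_1,\dots,S_n$ be representatives of the isomorphism classes of simple right $\Lambda$-modules, let $P_i$ be the projective cover of $S_i$, and for $\gamma\in\mathbb N^n$ put $P(\gamma)=\bigoplus_i P_i^{\gamma_i}$. The dimension vector of a finite dimensional module $M$ is $\underline{\dim}\,M=(\dim_{F_i}\operatorname{Hom}_\Lambda(P_i,M))_i$, where $F_i=\operatorname{End}_\Lambda(P_i)$. Let $\mathrm{Pres}(\Lambda)$ be the category whose objects (presentations) are the chain complexes $X_1\to X_0$ of finitely generated projective right $\Lambda$-modules in degrees $1$ and $0$, and whose morphisms are the homotopy classes of chain maps of degree $0$; for two presentations let $\operatorname{Ext}^1_{\mathrm{Pres}(\Lambda)}(X,Y)$ be the space of homotopy classes of chain maps $X\to Y[1]$. Let $\gamma_0,\gamma_1\in\mathbb N^n$, and let $P(\gamma_*)=(p:P(\gamma_1)\to P(\gamma_0))$ be a presentation with dimension vector $\underline{\dim}\,P(\gamma_0)-\underline{\dim}\,P(\gamma_1)=\alpha\in\mathbb Z^n$ such that $\operatorname{Ext}^1_{\mathrm{Pres}(\Lambda)}(P(\gamma_*),P(\gamma_*))=0$.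 Then the set of all $f\in \mathrm{Pres}_\Lambda(\gamma_1,\gamma_0)=\operatorname{Hom}_\Lambda(P(\gamma_1),P(\gamma_0))$ such that the presentation $f:P(\gamma_1)\to P(\gamma_0)$ is isomorphic to $P(\gamma_*)$ in $\mathrm{Pres}(\Lambda)$ is open and dense in the Zariski topology on (the $K$-points of) the $K$-affine space $\mathrm{Pres}_\Lambda(\gamma_1,\gamma_0)$. -/

import Mathlib

open CategoryTheory

universe u v

/-- The ring `Λ` is right hereditary: every right ideal is a projective right module. (For a
finite dimensional algebra over a field this is the same as left hereditary.) -/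
def IsHereditary (Λ : Type v) [Ring Λ] : Prop :=
  ∀ I : Submodule Λᵐᵒᵖ Λ, Module.Projective Λᵐᵒᵖ I

/-- `π : P ⟶ S` is a projective cover: `P` is projective, `π` is surjective, and its kernel is
superfluous. -/
structure IsProjectiveCover {R : Type v} [Ring R] {P S : ModuleCat.{v} R} (π : P ⟶ S) : Prop where
  projective : Module.Projective R P
  surjective : Function.Surjective π.hom
  superfluous : ∀ N : Submodule R P, N ⊔ LinearMap.ker π.hom = ⊤ → N = ⊤

/-- The simple right `Λ`-modules `S 0, …, S (n - 1)` in a fixed order, one from each isomorphism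
class, together with their projective covers `π i : P i ⟶ S i`. Right `Λ`-modules are modules over
`Λᵐᵒᵖ`. -/
structure SimpleCovers (Λ : Type v) [Ring Λ] (n : ℕ) where
  S : Fin n → ModuleCat.{v} Λᵐᵒᵖ
  simple : ∀ i, IsSimpleModule Λᵐᵒᵖ (S i)
  eq_of_iso : ∀ i j, Nonempty (S i ≅ S j) → i = j
  exists_iso : ∀ M : ModuleCat.{v} Λᵐᵒᵖ, IsSimpleModule Λᵐᵒᵖ M → ∃ i, Nonempty (M ≅ S i)
  P : Fin n → ModuleCat.{v} Λᵐᵒᵖ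
  π : ∀ i, P i ⟶ S i
  cover : ∀ i, IsProjectiveCover (π i)

namespace SimpleCovers

variable {Λ : Type v} [Ring Λ] {n : ℕ} (D : SimpleCovers Λ n)

/-- `P(γ) = ⨁ i, (P i) ^ (γ i)`. -/
def proj (γ : Fin n → ℕ) : ModuleCat.{v} Λᵐᵒᵖ :=
  ModuleCat.of Λᵐᵒᵖ (∀ i, Fin (γ i) → D.P i)

theorem finite_P (i : Fin n) : Module.Finite Λᵐᵒᵖ (D.P i) := by
  have := D.simple i
  have := IsSimpleModule.nontrivial Λᵐᵒᵖ (D.S i)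
  obtain ⟨s, hs⟩ := exists_ne (0 : D.S i)
  obtain ⟨x, rfl⟩ := (D.cover i).surjective s
  refine ⟨⟨{x}, (D.cover i).superfluous _ ?_⟩⟩
  rw [eq_top_iff]
  rintro y -
  have hy : (D.π i).hom y ∈ Submodule.span Λᵐᵒᵖ {(D.π i).hom x} := by
    rw [IsSimpleModule.span_singleton_eq_top Λᵐᵒᵖ hs]
    trivial
  obtain ⟨r, hr⟩ := Submodule.mem_span_singleton.1 hy
  have h : y = r • x + (y - r • x) := by abel
  rw [h]
  refine Submodule.add_mem_sup (Submodule.smul_mem _ _ (Submodule.subset_span (by simp))) ?_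
  simp [LinearMap.mem_ker, hr]

theorem finite_proj (γ : Fin n → ℕ) : Module.Finite Λᵐᵒᵖ (D.proj γ) := by
  have := D.finite_P
  exact inferInstanceAs (Module.Finite Λᵐᵒᵖ (∀ i, Fin (γ i) → D.P i))

theorem projective_proj (γ : Fin n → ℕ) : Module.Projective Λᵐᵒᵖ (D.proj γ) := by
  have := fun i => (D.cover i).projective
  have h (i : Fin n) : Module.Projective Λᵐᵒᵖ (Fin (γ i) → D.P i) :=
    .of_equiv (DFinsupp.linearEquivFunOnFintype (R := Λᵐᵒᵖ) (M := fun _ : Fin (γ i) => D.P i))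
  exact .of_equiv (M := Π₀ i, Fin (γ i) → D.P i)
    (DFinsupp.linearEquivFunOnFintype (R := Λᵐᵒᵖ) (M := fun i => Fin (γ i) → D.P i))

/-- The dimension vector of a right module: the `i`-th coordinate is the dimension of
`Hom(P i, M)` over the division algebra `F i = End (P i)` (acting by precomposition). -/
noncomputable def dimVec (M : ModuleCat.{v} Λᵐᵒᵖ) (i : Fin n) : ℕ :=
  Module.finrank (End (D.P i))ᵐᵒᵖ (D.P i ⟶ M)

/-- The presentation space `Hom(P(γ₁), P(γ₀))`, a vector space over `K` whenever `Λ` is a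
`K`-algebra. -/
abbrev PresSpace (γ₁ γ₀ : Fin n → ℕ) : Type v := D.proj γ₁ ⟶ D.proj γ₀

end SimpleCovers

/-- Objects of the category of presentations: maps `X₁ ⟶ X₀` between finitely generated
projective right `Λ`-modules. -/
structure Pres (Λ : Type v) [Ring Λ] where
  X₁ : ModuleCat.{v} Λᵐᵒᵖ
  X₀ : ModuleCat.{v} Λᵐᵒᵖ
  finite₁ : Module.Finite Λᵐᵒᵖ X₁
  finite₀ : Module.Finite Λᵐᵒᵖ X₀
  projective₁ : Module.Projective Λᵐᵒᵖ X₁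
  projective₀ : Module.Projective Λᵐᵒᵖ X₀
  map : X₁ ⟶ X₀

namespace Pres

variable {Λ : Type v} [Ring Λ]

/-- A presentation as a complex, with `X₁` in homological degree `1` (cohomological degree `-1`)
and `X₀` in degree `0`. -/
noncomputable def complex (X : Pres Λ) : CochainComplex (ModuleCat.{v} Λᵐᵒᵖ) ℤ :=
  HomologicalComplex.double X.map (c := ComplexShape.up ℤ) (i₀ := -1) (i₁ := 0) (by simp)

/-- A presentation as an object of the homotopy category of complexes of right modules. -/
noncomputable def toHomotopyCategory (X : Pres Λ) :
    HomotopyCategory (ModuleCat.{v} Λᵐᵒᵖ) (ComplexShape.up ℤ) :=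
  (HomotopyCategory.quotient _ _).obj X.complex

/-- Morphisms of presentations are homotopy classes of chain maps of degree `0`. -/
noncomputable instance : Category (Pres Λ) :=
  inferInstanceAs (Category (InducedCategory _ (toHomotopyCategory (Λ := Λ))))

/-- `Ext¹` in the category of presentations: homotopy classes of chain maps `X ⟶ Y[1]`. -/
noncomputable abbrev Ext1 (X Y : Pres Λ) : Type v :=
  X.toHomotopyCategory ⟶ (shiftFunctor _ (1 : ℤ)).obj Y.toHomotopyCategory

end Pres

/-- The presentation `P(γ₁) ⟶ P(γ₀)` given by an element of the presentation space. -/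
def SimpleCovers.pres {Λ : Type v} [Ring Λ] {n : ℕ} (D : SimpleCovers Λ n)
    {γ₁ γ₀ : Fin n → ℕ} (p : D.PresSpace γ₁ γ₀) : Pres Λ where
  X₁ := D.proj γ₁
  X₀ := D.proj γ₀
  finite₁ := D.finite_proj γ₁
  finite₀ := D.finite_proj γ₀
  projective₁ := D.projective_proj γ₁
  projective₀ := D.projective_proj γ₀
  map := p

/-- The dimension vector of the presentation `p : P(γ₁) ⟶ P(γ₀)`. -/
noncomputable def SimpleCovers.presDimVec {Λ : Type v} [Ring Λ] {n : ℕ} (D : SimpleCovers Λ n)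
    {γ₁ γ₀ : Fin n → ℕ} (_p : D.PresSpace γ₁ γ₀) (i : Fin n) : ℤ :=
  (D.dimVec (D.proj γ₀) i : ℤ) - (D.dimVec (D.proj γ₁) i : ℤ)

/-- The polynomial functions on a vector space: the algebra of functions generated by the linear
functionals. -/
def polyFunctions (K : Type u) (V : Type v) [Field K] [AddCommGroup V] [Module K V] :
    Subalgebra K (V → K) :=
  Algebra.adjoin K (Set.range fun φ : Module.Dual K V => (φ : V → K))

/-- The Zariski topology on the set of `K`-points of a `K`-vector space, considered as an affine
space over `K`: the open sets are the unions of nonvanishing sets of polynomial functions. -/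
abbrev zariskiTopology (K : Type u) (V : Type v) [Field K] [AddCommGroup V] [Module K V] :
    TopologicalSpace V :=
  TopologicalSpace.generateFrom {U | ∃ f ∈ polyFunctions K V, U = {v | f v ≠ 0}}

/-! Let `f : X₁ ⟶ X₀` have `Ext¹(f, f) = 0`. Spelled out, every `g : X₁ ⟶ X₀` is of the form
`a ≫ f - f ≫ b`, so the linear map `Φ h (a, b) = a ≫ h - f ≫ b` on `End X₁ × End X₀` is surjective
for `h = f`, and it kills `(1, 1)`. Cramer's rule extends `(1, 1)` to an element of `ker (Φ h)`
depending polynomially on `h`. Invertibility in a finite dimensional algebra is the nonvanishing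
of the norm, so this element is invertible for `h` in a Zariski neighbourhood of `f`, and it is
then an isomorphism of arrows from `f` to `h`. As the vanishing of `Ext¹` only depends on the
isomorphism class, the whole class is open; it is dense because an affine space over an infinite
field is irreducible. -/

/-- Polynomial maps between vector spaces, possibly of infinite dimension: the maps whose
composition with every linear functional is a polynomial function. -/
def IsPolyMap (K : Type*) [Field K] {V W : Type*} [AddCommGroup V] [Module K V]
    [AddCommGroup W] [Module K W] (q : V → W) : Prop :=
  ∀ φ : Module.Dual K W, (fun v => φ (q v)) ∈ polyFunctions K V

section PolynomialMaps

variable {K : Type*} [Field K] {V W W₁ W₂ : Type*} [AddCommGroup V] [Module K V]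
  [AddCommGroup W] [Module K W] [AddCommGroup W₁] [Module K W₁] [AddCommGroup W₂] [Module K W₂]

namespace IsPolyMap

theorem const (w : W) : IsPolyMap K (fun _ : V => w) := fun φ =>
  (polyFunctions K V).algebraMap_mem (φ w)

theorem of_linearMap (L : V →ₗ[K] W) : IsPolyMap K L := fun φ =>
  Algebra.subset_adjoin ⟨φ ∘ₗ L, rfl⟩

theorem sub {q r : V → W} (hq : IsPolyMap K q) (hr : IsPolyMap K r) :
    IsPolyMap K (fun v => q v - r v) := fun φ => by
  simp only [map_sub]
  exact (polyFunctions K V).sub_mem (hq φ) (hr φ)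

theorem smul {c : V → K} {q : V → W} (hc : c ∈ polyFunctions K V) (hq : IsPolyMap K q) :
    IsPolyMap K (fun v => c v • q v) := fun φ => by
  simp only [map_smul]
  exact (polyFunctions K V).mul_mem hc (hq φ)

theorem sum {ι : Type*} (s : Finset ι) {q : ι → V → W} (hq : ∀ i ∈ s, IsPolyMap K (q i)) :
    IsPolyMap K (fun v => ∑ i ∈ s, q i v) := fun φ => by
  simpa only [map_sum, Finset.sum_fn] using (polyFunctions K V).sum_mem fun i hi => hq i hi φ

theorem comp_mem_polyFunctions {q : V → W} (hq : IsPolyMap K q) {f : W → K}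
    (hf : f ∈ polyFunctions K W) : (fun v => f (q v)) ∈ polyFunctions K V := by
  induction hf using Algebra.adjoin_induction with
  | mem f hf => obtain ⟨φ, rfl⟩ := hf; exact hq φ
  | algebraMap c => exact (polyFunctions K V).algebraMap_mem c
  | add f g _ _ hf hg => exact (polyFunctions K V).add_mem hf hg
  | mul f g _ _ hf hg => exact (polyFunctions K V).mul_mem hf hg

theorem comp {r : W → W₁} {q : V → W} (hr : IsPolyMap K r) (hq : IsPolyMap K q) :
    IsPolyMap K (fun v => r (q v)) := fun φ => hq.comp_mem_polyFunctions (hr φ)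

theorem of_basis {ι : Type*} [Finite ι] (e : Module.Basis ι K W) {q : V → W}
    (hq : ∀ i, (fun v => e.repr (q v) i) ∈ polyFunctions K V) : IsPolyMap K q := by
  have := Fintype.ofFinite ι
  have hsum : IsPolyMap K fun v => ∑ i, e.repr (q v) i • e i :=
    sum _ fun i _ => smul (hq i) (const (e i))
  simpa only [e.sum_repr] using hsum

theorem bilinear [FiniteDimensional K W₁] (B : W₁ →ₗ[K] W₂ →ₗ[K] W) {q : V → W₁} {r : V → W₂}
    (hq : IsPolyMap K q) (hr : IsPolyMap K r) : IsPolyMap K (fun v => B (q v) (r v)) := by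
  let e := Module.finBasis K W₁
  have expand (v : V) : B (q v) (r v) = ∑ i, e.repr (q v) i • B (e i) (r v) := by
    conv_lhs => rw [← e.sum_repr (q v)]
    simp only [map_sum, map_smul, LinearMap.sum_apply, LinearMap.smul_apply]
  simp only [expand]
  exact sum _ fun i _ => smul (hq (e.coord i)) ((of_linearMap (B (e i))).comp hr)

end IsPolyMap

end PolynomialMaps

section Adjugate

variable {K : Type*} [Field K]

section Matrix

/-- The matrix of coordinate functions on the space of square matrices. Identities between
determinants and adjugates over the ring of polynomial functions specialize to each matrix. -/
def genericMatrix (K ι : Type*) [Field K] : Matrix ι ι (polyFunctions K (Matrix ι ι K)) :=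
  fun i j => ⟨fun M => M i j, Algebra.subset_adjoin ⟨Matrix.entryLinearMap K K i j, rfl⟩⟩

/-- Evaluation of polynomial functions at a point, as a ring homomorphism. -/
def polyEval {V : Type*} [AddCommGroup V] [Module K V] (v : V) : polyFunctions K V →+* K :=
  (Pi.evalRingHom (fun _ : V => K) v).comp (polyFunctions K V).val.toRingHom

variable {ι : Type*} [Fintype ι] [DecidableEq ι]

theorem mapMatrix_polyEval_genericMatrix (M : Matrix ι ι K) :
    (polyEval M).mapMatrix (genericMatrix K ι) = M := rfl

theorem det_mem_polyFunctions :
    (Matrix.det : Matrix ι ι K → K) ∈ polyFunctions K (Matrix ι ι K) := by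
  have h : Matrix.det = ((genericMatrix K ι).det : Matrix ι ι K → K) := by
    funext M
    exact (congrArg Matrix.det (mapMatrix_polyEval_genericMatrix M)).symm.trans
      ((polyEval M).map_det (genericMatrix K ι)).symm
  exact h ▸ (genericMatrix K ι).det.2

theorem isPolyMap_adjugate : IsPolyMap K (Matrix.adjugate : Matrix ι ι K → Matrix ι ι K) := by
  refine .of_basis (Matrix.stdBasis K ι ι) fun ⟨i, j⟩ => ?_
  have h : (fun M : Matrix ι ι K => (Matrix.stdBasis K ι ι).repr M.adjugate (i, j)) =
      ((genericMatrix K ι).adjugate i j : Matrix ι ι K → K) := by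
    funext M
    have hM := (polyEval M).map_adjugate (genericMatrix K ι)
    rw [mapMatrix_polyEval_genericMatrix] at hM
    exact congrFun₂ hM.symm i j
  exact h ▸ ((genericMatrix K ι).adjugate i j).2

end Matrix

variable {V W : Type*} [AddCommGroup V] [Module K V] [AddCommGroup W] [Module K W]

theorem linearMap_det_mem_polyFunctions [FiniteDimensional K W] :
    (LinearMap.det : Module.End K W → K) ∈ polyFunctions K (Module.End K W) := by
  let e := Module.finBasis K W
  simpa using (IsPolyMap.of_linearMap (LinearMap.toMatrix e e).toLinearMap).comp_mem_polyFunctions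
    det_mem_polyFunctions

theorem exists_isPolyMap_mul_eq_det_smul_one [FiniteDimensional K W] :
    ∃ adj : Module.End K W → Module.End K W, IsPolyMap K adj ∧
      ∀ f, f * adj f = LinearMap.det f • 1 := by
  let e := Module.finBasis K W
  let toMatrix : Module.End K W ≃ₐ[K] _ := LinearMap.toMatrixAlgEquiv e
  refine ⟨fun f => toMatrix.symm (toMatrix f).adjugate, ?_, fun f => ?_⟩
  · exact (IsPolyMap.of_linearMap toMatrix.symm.toLinearMap).comp
      (isPolyMap_adjugate.comp (.of_linearMap toMatrix.toLinearMap))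
  · apply toMatrix.injective
    rw [map_mul, toMatrix.apply_symm_apply, Matrix.mul_adjugate, map_smul, map_one,
      ← LinearMap.det_toMatrix e]
    rfl

theorem exists_isPolyMap_mem_ker {E : Type*} [AddCommGroup E] [Module K E]
    [FiniteDimensional K W] {Φ : V → E →ₗ[K] W} (hΦ : IsPolyMap K Φ) {x : V}
    (hx : Function.Surjective (Φ x)) {e : E} (he : Φ x e = 0) :
    ∃ s : V → E, IsPolyMap K s ∧ s x = e ∧ ∀ v, Φ v (s v) = 0 := by
  obtain ⟨σ, hσ⟩ := (Φ x).exists_rightInverse_of_surjective (LinearMap.range_eq_top.2 hx)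
  obtain ⟨adj, hadj, mul_adj⟩ := exists_isPolyMap_mul_eq_det_smul_one (K := K) (W := W)
  have hΦσ : IsPolyMap K fun v => Φ v ∘ₗ σ :=
    (IsPolyMap.of_linearMap (LinearMap.lcomp K W σ)).comp hΦ
  -- Cramer's rule: where `Φ v ∘ₗ σ` is invertible, this is a multiple of the projection of `e`
  -- to `ker (Φ v)` along the range of `σ`.
  refine ⟨fun v => LinearMap.det (Φ v ∘ₗ σ) • e - σ (adj (Φ v ∘ₗ σ) (Φ v e)), ?_, ?_, fun v => ?_⟩
  · have hdet := hΦσ.comp_mem_polyFunctions linearMap_det_mem_polyFunctions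
    have hadjΦ := IsPolyMap.bilinear LinearMap.id (hadj.comp hΦσ)
      ((IsPolyMap.of_linearMap (LinearMap.applyₗ e)).comp hΦ)
    exact (IsPolyMap.smul hdet (.const e)).sub ((IsPolyMap.of_linearMap σ).comp hadjΦ)
  · simp [hσ, he]
  · have cramer : Φ v (σ (adj (Φ v ∘ₗ σ) (Φ v e))) = LinearMap.det (Φ v ∘ₗ σ) • Φ v e :=
      LinearMap.congr_fun (mul_adj (Φ v ∘ₗ σ)) (Φ v e)
    rw [map_sub, map_smul, cramer, sub_self]

end Adjugate

section ZariskiTopology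

variable {K : Type*} [Field K] {V W : Type*} [AddCommGroup V] [Module K V]
  [AddCommGroup W] [Module K W]

theorem isOpen_setOf_ne_zero_of_mem_polyFunctions {f : V → K} (hf : f ∈ polyFunctions K V) :
    @IsOpen V (zariskiTopology K V) {v | f v ≠ 0} :=
  TopologicalSpace.isOpen_generateFrom_of_mem ⟨f, hf, rfl⟩

theorem IsPolyMap.continuous {q : V → W} (hq : IsPolyMap K q) :
    @Continuous V W (zariskiTopology K V) (zariskiTopology K W) q := by
  let := zariskiTopology K V
  refine continuous_generateFrom_iff.2 ?_
  rintro _ ⟨f, hf, rfl⟩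
  exact isOpen_setOf_ne_zero_of_mem_polyFunctions (hq.comp_mem_polyFunctions hf)

theorem isTopologicalBasis_zariskiTopology :
    @TopologicalSpace.IsTopologicalBasis V (zariskiTopology K V)
      {U | ∃ f ∈ polyFunctions K V, U = {v | f v ≠ 0}} := by
  let := zariskiTopology K V
  refine ⟨?_, Set.eq_univ_of_forall fun x => ⟨_, ⟨1, one_mem _, rfl⟩, one_ne_zero⟩, rfl⟩
  rintro _ ⟨f, hf, rfl⟩ _ ⟨g, hg, rfl⟩ x ⟨hfx, hgx⟩
  exact ⟨_, ⟨f * g, mul_mem hf hg, rfl⟩, mul_ne_zero hfx hgx, fun y hy =>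
    ⟨left_ne_zero_of_mul hy, right_ne_zero_of_mul hy⟩⟩

theorem exists_polynomial_eval_eq_lineMap {f : V → K} (hf : f ∈ polyFunctions K V) (x y : V) :
    ∃ P : Polynomial K, ∀ t, P.eval t = f (AffineMap.lineMap x y t) := by
  induction hf using Algebra.adjoin_induction with
  | mem f hf =>
    obtain ⟨φ, rfl⟩ := hf
    exact ⟨.X * .C (φ (y - x)) + .C (φ x), fun t => by simp [AffineMap.lineMap_apply]⟩
  | algebraMap c => exact ⟨.C c, fun t => by simp⟩
  | add f g _ _ hf hg =>
    obtain ⟨P, hP⟩ := hf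
    obtain ⟨Q, hQ⟩ := hg
    exact ⟨P + Q, fun t => by simp [hP, hQ]⟩
  | mul f g _ _ hf hg =>
    obtain ⟨P, hP⟩ := hf
    obtain ⟨Q, hQ⟩ := hg
    exact ⟨P * Q, fun t => by simp [hP, hQ]⟩

theorem exists_ne_zero_and_ne_zero_of_mem_polyFunctions [Infinite K] {f g : V → K}
    (hf : f ∈ polyFunctions K V) (hg : g ∈ polyFunctions K V) {x y : V} (hx : f x ≠ 0)
    (hy : g y ≠ 0) : ∃ z, f z ≠ 0 ∧ g z ≠ 0 := by
  obtain ⟨P, hP⟩ := exists_polynomial_eval_eq_lineMap hf x y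
  obtain ⟨Q, hQ⟩ := exists_polynomial_eval_eq_lineMap hg x y
  have hP0 : P ≠ 0 := by
    rintro rfl
    exact hx (by simpa using (hP 0).symm)
  have hQ0 : Q ≠ 0 := by
    rintro rfl
    exact hy (by simpa using (hQ 1).symm)
  obtain ⟨t, ht⟩ : ∃ t, (P * Q).eval t ≠ 0 := by
    by_contra! h
    exact mul_ne_zero hP0 hQ0 (Polynomial.funext (by simpa using h))
  rw [Polynomial.eval_mul, hP, hQ] at ht
  exact ⟨_, left_ne_zero_of_mul ht, right_ne_zero_of_mul ht⟩

theorem preirreducibleSpace_zariskiTopology [Infinite K] :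
    @PreirreducibleSpace V (zariskiTopology K V) := by
  let := zariskiTopology K V
  have basis := isTopologicalBasis_zariskiTopology (K := K) (V := V)
  refine ⟨fun U U' hU hU' ⟨x, _, hx⟩ ⟨y, _, hy⟩ => ?_⟩
  obtain ⟨_, ⟨f, hf, rfl⟩, hfx, hfU⟩ := basis.exists_subset_of_mem_open hx hU
  obtain ⟨_, ⟨g, hg, rfl⟩, hgy, hgU⟩ := basis.exists_subset_of_mem_open hy hU'
  obtain ⟨z, hfz, hgz⟩ := exists_ne_zero_and_ne_zero_of_mem_polyFunctions hf hg hfx hgy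
  exact ⟨z, trivial, hfU hfz, hgU hgz⟩

variable {A : Type*} [Ring A] [Algebra K A] [FiniteDimensional K A]

theorem norm_mem_polyFunctions : (Algebra.norm K : A → K) ∈ polyFunctions K A :=
  (IsPolyMap.of_linearMap (LinearMap.mul K A)).comp_mem_polyFunctions
    linearMap_det_mem_polyFunctions

theorem norm_ne_zero_iff_isUnit (a : A) : Algebra.norm K a ≠ 0 ↔ IsUnit a := by
  rw [Algebra.norm_apply, ← isUnit_iff_ne_zero, ← LinearMap.isUnit_iff_isUnit_det,
    Algebra.lmul_isUnit_iff]

theorem isOpen_setOf_isUnit : @IsOpen A (zariskiTopology K A) {a | IsUnit a} := by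
  simpa only [norm_ne_zero_iff_isUnit] using
    isOpen_setOf_ne_zero_of_mem_polyFunctions (norm_mem_polyFunctions (K := K) (A := A))

theorem setOf_exists_isUnit_mem_ker_mem_nhds [FiniteDimensional K W] {Φ : V → A →ₗ[K] W}
    (hΦ : IsPolyMap K Φ) {x : V} (hx : Function.Surjective (Φ x)) (hx1 : Φ x 1 = 0) :
    {v | ∃ u, IsUnit u ∧ Φ v u = 0} ∈ @nhds V (zariskiTopology K V) x := by
  let := zariskiTopology K V
  let := zariskiTopology K A
  obtain ⟨s, hs, hsx, hker⟩ := exists_isPolyMap_mem_ker hΦ hx hx1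
  have hopen : IsOpen {v | IsUnit (s v)} :=
    (isOpen_setOf_isUnit (K := K)).preimage hs.continuous
  have hmem : IsUnit (s x) := hsx ▸ isUnit_one
  exact Filter.mem_of_superset (hopen.mem_nhds hmem) fun v hv => ⟨s v, hv, hker v⟩

end ZariskiTopology

section ArrowOrbits

variable {K : Type*} [Field K] {C : Type*} [Category* C] [Preadditive C] [Linear K C]

theorem setOf_nonempty_arrow_iso_mem_nhds {X Y : C} [FiniteDimensional K (X ⟶ Y)]
    [FiniteDimensional K (X ⟶ X)] [FiniteDimensional K (Y ⟶ Y)] {f : X ⟶ Y}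
    (hf : ∀ g : X ⟶ Y, ∃ (a : X ⟶ X) (b : Y ⟶ Y), g = a ≫ f - f ≫ b) :
    {g : X ⟶ Y | Nonempty (Arrow.mk f ≅ Arrow.mk g)} ∈
      @nhds _ (zariskiTopology K (X ⟶ Y)) f := by
  have : FiniteDimensional K (End X) := ‹FiniteDimensional K (X ⟶ X)›
  have : FiniteDimensional K (End Y) := ‹FiniteDimensional K (Y ⟶ Y)›
  let precomp : (X ⟶ Y) →ₗ[K] End X × End Y →ₗ[K] (X ⟶ Y) :=
    LinearMap.lcomp K (X ⟶ Y) (LinearMap.fst K (End X) (End Y)) ∘ₗ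
      (Linear.comp (S := K) X X Y).flip
  let postcomp : End X × End Y →ₗ[K] (X ⟶ Y) := Linear.leftComp K Y f ∘ₗ LinearMap.snd K _ _
  have hpoly : IsPolyMap K fun g => precomp g - postcomp :=
    (IsPolyMap.of_linearMap precomp).sub (.const postcomp)
  have hsurj : Function.Surjective (precomp f - postcomp) := fun g => by
    obtain ⟨a, b, rfl⟩ := hf g
    exact ⟨(a, b), rfl⟩
  have hone : (precomp f - postcomp) 1 = 0 :=
    sub_eq_zero.2 ((Category.id_comp f).trans (Category.comp_id f).symm)
  refine Filter.mem_of_superset (setOf_exists_isUnit_mem_ker_mem_nhds hpoly hsurj hone) ?_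
  rintro g ⟨⟨a, b⟩, hab, hg⟩
  obtain ⟨ha, hb⟩ := Prod.isUnit_iff.1 hab
  have := (isUnit_iff_isIso a).1 ha
  have := (isUnit_iff_isIso b).1 hb
  exact ⟨Arrow.isoMk (asIso a) (asIso b) (sub_eq_zero.1 hg)⟩

end ArrowOrbits

section Complexes

open HomologicalComplex in
/-- The functor sending a morphism to the complex concentrated in two consecutive degrees that it
defines; it makes isomorphic arrows into isomorphic complexes. -/
noncomputable def doubleFunctor {C : Type*} [Category* C] [Limits.HasZeroMorphisms C]
    [Limits.HasZeroObject C] {ι : Type*} {c : ComplexShape ι} {i₀ i₁ : ι} (hi : c.Rel i₀ i₁)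
    (hne : i₀ ≠ i₁) : Arrow C ⥤ HomologicalComplex C c where
  obj f := double f.hom hi
  map {f g} φ := mkHomFromDouble hi hne (φ.left ≫ (doubleXIso₀ g.hom hi).inv)
    (φ.right ≫ (doubleXIso₁ g.hom hi hne).inv) (by simp [double_d _ _ hne])
    (fun k _ => by simp [double_d_eq_zero₀ _ _ _ _ hne.symm])
  map_id f := by ext <;> simp
  map_comp φ ψ := by ext <;> simp

open CochainComplex.HomComplex in
theorem exists_eq_comp_d_sub_d_comp_of_subsingleton {C : Type*} [Category* C] [Preadditive C]
    {L M : CochainComplex C ℤ}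
    (h : Subsingleton ((HomotopyCategory.quotient C (.up ℤ)).obj L ⟶
      (HomotopyCategory.quotient C (.up ℤ)).obj (M⟦(1 : ℤ)⟧)))
    {p q : ℤ} (hpq : p + 1 = q) (g : L.X p ⟶ M.X q) (hL : ∀ i, L.d i p ≫ g = 0)
    (hM : ∀ j, g ≫ M.d q j = 0) :
    ∃ (a : L.X p ⟶ M.X p) (b : L.X q ⟶ M.X q), g = a ≫ M.d p q - L.d p q ≫ b := by
  have hδ : δ 1 2 (Cochain.single g 1) = 0 := by
    simp [Cochain.δ_single g 1 2 rfl (p - 1) (q + 1) (by lia) rfl, hL, hM]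
  let z : Cocycle L M 1 := .mk (.single g 1) 2 rfl hδ
  obtain ⟨β, hβ⟩ := (mem_coboundaries_iff z 0 rfl).1
    ((CohomologyClass.toHom_mk_eq_zero_iff z).1 (h.elim _ _))
  refine ⟨β.v p p (by lia), β.v q q (by lia), ?_⟩
  calc g = (Cochain.single g 1).v p q hpq := (Cochain.single_v g 1 hpq).symm
    _ = (δ 0 1 β).v p q hpq := by rw [hβ]; rfl
    _ = β.v p p (by lia) ≫ M.d p q - L.d p q ≫ β.v q q (by lia) := by
      simp [δ_v 0 1 rfl β p q hpq p q (by lia) hpq, sub_eq_add_neg]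

open HomologicalComplex in
theorem exists_eq_comp_sub_comp_of_subsingleton_double {C : Type*} [Category* C] [Preadditive C]
    [Limits.HasZeroObject C] {X₁ X₀ Y₁ Y₀ : C} {f : X₁ ⟶ X₀} {f' : Y₁ ⟶ Y₀} {p q : ℤ}
    (hpq : (ComplexShape.up ℤ).Rel p q)
    (h : Subsingleton ((HomotopyCategory.quotient C (.up ℤ)).obj (double f hpq) ⟶
      (HomotopyCategory.quotient C (.up ℤ)).obj ((double f' hpq)⟦(1 : ℤ)⟧)))
    (g : X₁ ⟶ Y₀) : ∃ (a : X₁ ⟶ Y₁) (b : X₀ ⟶ Y₀), g = a ≫ f' - f ≫ b := by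
  have hne : p ≠ q := by rintro rfl; simp at hpq
  let x₁ := doubleXIso₀ f hpq
  let x₀ := doubleXIso₁ f hpq hne
  let y₁ := doubleXIso₀ f' hpq
  let y₀ := doubleXIso₁ f' hpq hne
  obtain ⟨a, b, hab⟩ := exists_eq_comp_d_sub_d_comp_of_subsingleton h hpq
    (x₁.hom ≫ g ≫ y₀.inv)
    (fun i => by rw [double_d_eq_zero₁ _ _ _ _ hne, Limits.zero_comp])
    (fun j => by rw [double_d_eq_zero₀ _ _ _ _ hne.symm, Limits.comp_zero])
  rw [double_d _ _ hne, double_d _ _ hne] at hab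
  refine ⟨x₁.inv ≫ a ≫ y₁.hom, x₀.inv ≫ b ≫ y₀.hom, ?_⟩
  calc g = x₁.inv ≫ (x₁.hom ≫ g ≫ y₀.inv) ≫ y₀.hom := by simp
    _ = (x₁.inv ≫ a ≫ y₁.hom) ≫ f' - f ≫ x₀.inv ≫ b ≫ y₀.hom := by
      rw [hab]
      simp [x₁, x₀, y₁, y₀]

end Complexes

namespace Pres

variable {Λ : Type v} [Ring Λ] {X Y : Pres Λ}

attribute [instance] finite₁ finite₀

theorem nonempty_iso_of_arrow_iso (e : Arrow.mk X.map ≅ Arrow.mk Y.map) : Nonempty (X ≅ Y) :=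
  ⟨InducedCategory.isoMk ((HomotopyCategory.quotient _ _).mapIso
    ((doubleFunctor (c := .up ℤ) (i₀ := -1) (i₁ := 0) (by simp) (by decide)).mapIso e))⟩

theorem subsingleton_ext1_congr (e : X ≅ Y) :
    Subsingleton (Ext1 X X) ↔ Subsingleton (Ext1 Y Y) :=
  let e' : X.toHomotopyCategory ≅ Y.toHomotopyCategory :=
    (inducedFunctor (toHomotopyCategory (Λ := Λ))).mapIso e
  (e'.homCongr ((shiftFunctor _ (1 : ℤ)).mapIso e')).subsingleton_congr

theorem exists_eq_comp_map_sub_map_comp (h : Subsingleton (Ext1 X Y)) (g : X.X₁ ⟶ Y.X₀) :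
    ∃ (a : X.X₁ ⟶ Y.X₁) (b : X.X₀ ⟶ Y.X₀), g = a ≫ Y.map - X.map ≫ b := by
  let e := ((HomotopyCategory.quotient (ModuleCat.{v} Λᵐᵒᵖ) (.up ℤ)).commShiftIso (1 : ℤ)).app
    Y.complex
  have h' : Subsingleton (X.toHomotopyCategory ⟶ (HomotopyCategory.quotient _ _).obj
      (Y.complex⟦(1 : ℤ)⟧)) := e.homToEquiv.subsingleton_congr.2 h
  exact exists_eq_comp_sub_comp_of_subsingleton_double (by simp) h' g

variable (K : Type*) [Field K] [Algebra K Λ]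

theorem isOpen_setOf_nonempty_iso [FiniteDimensional K (X.X₁ ⟶ X.X₁)]
    [FiniteDimensional K (X.X₁ ⟶ X.X₀)] [FiniteDimensional K (X.X₀ ⟶ X.X₀)]
    (hX : Subsingleton (Ext1 X X)) :
    @IsOpen _ (zariskiTopology K (X.X₁ ⟶ X.X₀))
      {f | Nonempty ({ X with map := f } ≅ X)} := by
  let := zariskiTopology K (X.X₁ ⟶ X.X₀)
  refine isOpen_iff_mem_nhds.2 ?_
  rintro f ⟨e⟩
  have rigid := exists_eq_comp_map_sub_map_comp ((subsingleton_ext1_congr e).2 hX)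
  refine Filter.mem_of_superset (setOf_nonempty_arrow_iso_mem_nhds rigid) ?_
  rintro g ⟨e'⟩
  obtain ⟨e''⟩ := nonempty_iso_of_arrow_iso (X := { X with map := f }) (Y := { X with map := g }) e'
  exact ⟨e''.symm ≪≫ e⟩

end Pres

instance finiteDimensional_moduleCat_hom (K : Type u) [Field K] {R : Type v} [Ring R] [Algebra K R]
    [Module.Finite K R] (M N : ModuleCat.{v} R) [Module.Finite R M] [Module.Finite R N] :
    FiniteDimensional K (M ⟶ N) := by
  let := ModuleCat.moduleOfAlgebraModule (k := K) M
  let := ModuleCat.moduleOfAlgebraModule (k := K) N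
  have := ModuleCat.isScalarTower_of_algebra_moduleCat (k := K) M
  have := ModuleCat.isScalarTower_of_algebra_moduleCat (k := K) N
  have : Module.Finite K M := .trans R M
  have : Module.Finite K N := .trans R N
  exact .of_injective (LinearMap.restrictScalarsₗ K R M N K ∘ₗ
    (ModuleCat.homLinearEquiv (S := K)).toLinearMap)
    ((LinearMap.restrictScalars_injective K).comp ModuleCat.homLinearEquiv.injective)

theorem theorem2p3p9_general (K : Type u) [Field K] [Infinite K] {Λ : Type v} [Ring Λ]
    [Algebra K Λ] (X : Pres Λ) [FiniteDimensional K (X.X₁ ⟶ X.X₁)]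
    [FiniteDimensional K (X.X₁ ⟶ X.X₀)] [FiniteDimensional K (X.X₀ ⟶ X.X₀)]
    (hX : Subsingleton (Pres.Ext1 X X)) :
    @IsOpen _ (zariskiTopology K (X.X₁ ⟶ X.X₀)) {f | Nonempty ({ X with map := f } ≅ X)} ∧
    @Dense _ (zariskiTopology K (X.X₁ ⟶ X.X₀)) {f | Nonempty ({ X with map := f } ≅ X)} := by
  let := zariskiTopology K (X.X₁ ⟶ X.X₀)
  have : PreirreducibleSpace (X.X₁ ⟶ X.X₀) := preirreducibleSpace_zariskiTopology (K := K)
  have hopen := Pres.isOpen_setOf_nonempty_iso K hX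
  exact ⟨hopen, hopen.dense ⟨X.map, ⟨Iso.refl X⟩⟩⟩

theorem theorem2p3p9 (K : Type u) [Field K] [Infinite K]
    (Λ : Type v) [Ring Λ] [Algebra K Λ] [Module.Finite K Λ] (hΛ : IsHereditary Λ)
    (n : ℕ) (D : SimpleCovers Λ n) (γ₁ γ₀ : Fin n → ℕ) (p : D.PresSpace γ₁ γ₀)
    (α : Fin n → ℤ) (hα : D.presDimVec p = α)
    (hp : Subsingleton (Pres.Ext1 (D.pres p) (D.pres p))) :
    @IsOpen _ (zariskiTopology K (D.PresSpace γ₁ γ₀))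
      {f : D.PresSpace γ₁ γ₀ | Nonempty (D.pres f ≅ D.pres p)} ∧
    @Dense _ (zariskiTopology K (D.PresSpace γ₁ γ₀))
      {f : D.PresSpace γ₁ γ₀ | Nonempty (D.pres f ≅ D.pres p)} :=
  theorem2p3p9_general K (D.pres p) hp
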